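/- Let $d\ge 2$, let $\Omega\subset\mathbb{R}^d$ be a nonempty bounded connected open set, and let $\varphi\in C(\partial\Omega)$. A *classical solution* of the Dirichlet problem $D(\varphi)$ is a function $u\in C(\overline\Omega)$ which is harmonic on $\Omega$ and satisfies $u|_{\partial\Omega}=\varphi$. Let $H^1_0(\Omega)$ be the closure of $C_c^\infty(\Omega)$ in $H^1(\Omega)$. An *admissible extension* of $\varphi$ is a function $\Phi\in C(\overline\Omega)$ with $\Phi|_{\partial\Omega}=\varphi$ and $\Delta\Phi\in H^{-1}(\Omega)$, i.e. such that for some $M\ge 0$ $$\Bigl|\int_\Omega \Phi\,\Delta w\,dx\Bigr|\le M\,\|w\|_{H^1(\Omega)}\qquad\text{for all } w\in C_c^\infty(\Omega).$$ A harmonic function $h$ on $\Omega$ is *the function produced by* $\Phi$ if $h=\Phi-v$ almost everywhere on $\Omega$, where $v\in H^1_0(\Omega)$ satisfies $$\int_\Omega \Phi\,\Delta w\,dx=-\int_\Omega\nabla v\cdot\nabla w\,dx\qquad\text{for all } w\in C_c^\infty(\Omega).$$ A *variational solution* of $D(\varphi)$ is a harmonic function on $\Omega$ produced by some admissible extension of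 $\varphi$. **Proposition.** Suppose that $D(\varphi)$ has a classical solution $u$. Then $u$ is equal on $\Omega$ to the variational solution $u_\varphi$ of $D(\varphi)$. That is, $u|_\Omega$ is a variational solution of $D(\varphi)$, it is the function produced by every admissible extension of $\varphi$, and every variational solution of $D(\varphi)$ coincides with $u$ on $\Omega$. -/

import Mathlib

open MeasureTheory Filter Topology
open scoped Distributions Laplacian Gradient

/-- `G` is the weak (distributional) gradient of `v` on `Ω`. It is only used below for
`v` and `G` square integrable on `Ω`, so that all the integrals converge. -/
def HasWeakGradient {d : ℕ} (Ω : TopologicalSpace.Opens (EuclideanSpace ℝ (Fin d)))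
    (v : EuclideanSpace ℝ (Fin d) → ℝ)
    (G : EuclideanSpace ℝ (Fin d) → EuclideanSpace ℝ (Fin d)) : Prop :=
  ∀ (w : 𝓓(Ω, ℝ)) (j : Fin d),
    ∫ x in (Ω : Set (EuclideanSpace ℝ (Fin d))), v x * (∇ w x) j
      = -∫ x in (Ω : Set (EuclideanSpace ℝ (Fin d))), (G x) j * w x

/-- `v` belongs to the Sobolev space `H¹(Ω)` and `G` is its weak gradient. -/
structure IsH1 {d : ℕ} (Ω : TopologicalSpace.Opens (EuclideanSpace ℝ (Fin d)))
    (v : EuclideanSpace ℝ (Fin d) → ℝ)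
    (G : EuclideanSpace ℝ (Fin d) → EuclideanSpace ℝ (Fin d)) : Prop where
  memLp : MemLp v 2 (volume.restrict Ω)
  memLp_grad : MemLp G 2 (volume.restrict Ω)
  hasWeakGradient : HasWeakGradient Ω v G

/-- `v` belongs to `H¹₀(Ω)`, the closure of the test functions in `H¹(Ω)`, and `G` is its weak
gradient: `v` and `G` are the `L²` limits of `wₙ` and `∇ wₙ` for some test functions `wₙ`. -/
structure IsH10 {d : ℕ} (Ω : TopologicalSpace.Opens (EuclideanSpace ℝ (Fin d)))
    (v : EuclideanSpace ℝ (Fin d) → ℝ)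
    (G : EuclideanSpace ℝ (Fin d) → EuclideanSpace ℝ (Fin d)) : Prop extends IsH1 Ω v G where
  exists_approx : ∃ w : ℕ → 𝓓(Ω, ℝ),
    Tendsto (fun n => eLpNorm (fun x => v x - w n x) 2 (volume.restrict Ω)) atTop (𝓝 0) ∧
    Tendsto (fun n => eLpNorm (fun x => G x - ∇ (w n) x) 2 (volume.restrict Ω)) atTop (𝓝 0)

/-- The `H¹(Ω)` norm of a test function. -/
noncomputable def testH1Norm {d : ℕ} (Ω : TopologicalSpace.Opens (EuclideanSpace ℝ (Fin d)))
    (w : 𝓓(Ω, ℝ)) : ℝ :=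
  Real.sqrt ((∫ x in (Ω : Set (EuclideanSpace ℝ (Fin d))), w x ^ 2)
    + ∫ x in (Ω : Set (EuclideanSpace ℝ (Fin d))), ‖∇ w x‖ ^ 2)

/-- The distributional Laplacian of `Φ` lies in `H⁻¹(Ω)`, that is, it is bounded on the
test functions for the `H¹(Ω)` norm. -/
def LaplacianMemHNegOne {d : ℕ} (Ω : TopologicalSpace.Opens (EuclideanSpace ℝ (Fin d)))
    (Φ : EuclideanSpace ℝ (Fin d) → ℝ) : Prop :=
  ∃ M : ℝ, 0 ≤ M ∧ ∀ w : 𝓓(Ω, ℝ),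
    |∫ x in (Ω : Set (EuclideanSpace ℝ (Fin d))), Φ x * (Δ (w : EuclideanSpace ℝ (Fin d) → ℝ)) x|
      ≤ M * testH1Norm Ω w

/-- `Φ` is an extension in `C(closure Ω)` of the boundary function `φ` with `ΔΦ ∈ H⁻¹(Ω)`.
Only the values of `Φ` on `closure Ω` matter. -/
structure IsAdmissibleExtension {d : ℕ}
    (Ω : TopologicalSpace.Opens (EuclideanSpace ℝ (Fin d)))
    (φ : C(frontier (Ω : Set (EuclideanSpace ℝ (Fin d))), ℝ))
    (Φ : EuclideanSpace ℝ (Fin d) → ℝ) : Prop where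
  continuousOn : ContinuousOn Φ (closure (Ω : Set (EuclideanSpace ℝ (Fin d))))
  boundary : ∀ z : frontier (Ω : Set (EuclideanSpace ℝ (Fin d))), Φ z = φ z
  laplacian : LaplacianMemHNegOne Ω Φ

/-- `h` is the harmonic function on `Ω` produced by the variational construction from `Φ`:
`h = Φ - v` almost everywhere on `Ω`, where `v ∈ H¹₀(Ω)` is the function with
`∫_Ω Φ Δw = -∫_Ω ∇v · ∇w` for all test functions `w`. -/
def IsVariationalSolutionFrom {d : ℕ}
    (Ω : TopologicalSpace.Opens (EuclideanSpace ℝ (Fin d)))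
    (Φ h : EuclideanSpace ℝ (Fin d) → ℝ) : Prop :=
  InnerProductSpace.HarmonicOnNhd h (Ω : Set (EuclideanSpace ℝ (Fin d))) ∧
  ∃ (v : EuclideanSpace ℝ (Fin d) → ℝ)
    (G : EuclideanSpace ℝ (Fin d) → EuclideanSpace ℝ (Fin d)),
    IsH10 Ω v G ∧
    (∀ w : 𝓓(Ω, ℝ),
      ∫ x in (Ω : Set (EuclideanSpace ℝ (Fin d))),
          Φ x * (Δ (w : EuclideanSpace ℝ (Fin d) → ℝ)) x
        = -∫ x in (Ω : Set (EuclideanSpace ℝ (Fin d))), inner ℝ (G x) (∇ w x)) ∧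
    ∀ᵐ x ∂(volume.restrict (Ω : Set (EuclideanSpace ℝ (Fin d)))), h x = Φ x - v x

/-- `h` is a variational solution of the Dirichlet problem `D(φ)` on `Ω`: it is produced by the
variational construction from some admissible extension of `φ`. -/
def IsVariationalSolution {d : ℕ}
    (Ω : TopologicalSpace.Opens (EuclideanSpace ℝ (Fin d)))
    (φ : C(frontier (Ω : Set (EuclideanSpace ℝ (Fin d))), ℝ))
    (h : EuclideanSpace ℝ (Fin d) → ℝ) : Prop :=
  ∃ Φ : EuclideanSpace ℝ (Fin d) → ℝ,
    IsAdmissibleExtension Ω φ Φ ∧ IsVariationalSolutionFrom Ω Φ h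

/-- `u` is a classical solution of `D(φ)`: it is continuous on `closure Ω`, harmonic on `Ω`, and
equal to `φ` on the boundary. -/
structure IsClassicalSolution {d : ℕ}
    (Ω : TopologicalSpace.Opens (EuclideanSpace ℝ (Fin d)))
    (φ : C(frontier (Ω : Set (EuclideanSpace ℝ (Fin d))), ℝ))
    (u : EuclideanSpace ℝ (Fin d) → ℝ) : Prop where
  continuousOn : ContinuousOn u (closure (Ω : Set (EuclideanSpace ℝ (Fin d))))
  harmonic : InnerProductSpace.HarmonicOnNhd u (Ω : Set (EuclideanSpace ℝ (Fin d)))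
  boundary : ∀ z : frontier (Ω : Set (EuclideanSpace ℝ (Fin d))), u z = φ z

/-!
Let `Φ` be an admissible extension and `u` the classical solution. Then `v = Φ - u`, extended by
`0`, is continuous and vanishes off `Ω`, and `Δv = ΔΦ ∈ H⁻¹(Ω)` because `u` is harmonic; the point
is that this forces `v ∈ H¹₀(Ω)`. Mollifying `v` and composing with a smooth soft threshold, which
cuts the values off near `0`, yields test functions `w` uniformly close to `v`. Averaging over small
translations preserves the `H⁻¹` bound, and the threshold is nondecreasing and `1`-Lipschitz, so
`∫ ‖∇w‖² ≤ M ‖w‖_{H¹}`; by the Poincaré inequality the `w` stay bounded in `H¹`, and weak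
compactness of balls puts their `L²` limit `v` in `H¹₀(Ω)`. Conversely, the element of `H¹₀(Ω)`
attached to `Φ` is unique, by the Poincaré inequality again.
-/

open TopologicalSpace
open scoped Convolution LineDeriv

section HilbertSpace

variable {H F : Type*} [NormedAddCommGroup H] [InnerProductSpace ℝ H] [CompleteSpace H]
  [NormedAddCommGroup F] [NormedSpace ℝ F]

theorem exists_norm_le_forall_tendsto_inner {ι : Type*} {l : Ultrafilter ι} {x : ι → H} {r : ℝ}
    (hx : ∀ᶠ i in l, ‖x i‖ ≤ r) :
    ∃ a : H, ‖a‖ ≤ r ∧ ∀ z : H, Tendsto (fun i => inner ℝ (x i) z) l (𝓝 (inner ℝ a z)) := by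
  let toWeakDual (z : H) : WeakDual ℝ H := StrongDual.toWeakDual (InnerProductSpace.toDual ℝ H z)
  obtain ⟨f, hf, hlim⟩ := (WeakDual.isCompact_closedBall (0 : StrongDual ℝ H) r
    ).ultrafilter_le_nhds (l.map fun i => toWeakDual (x i)) (le_principal_iff.mpr <|
      Filter.mem_map.mpr <| hx.mono fun i hi => by simpa [toWeakDual] using hi)
  refine ⟨(InnerProductSpace.toDual ℝ H).symm (WeakDual.toStrongDual f), by simpa using hf,
    fun z => ?_⟩
  rw [InnerProductSpace.toDual_symm_apply]
  exact ((WeakDual.eval_continuous z).tendsto f).comp hlim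

theorem isClosed_image_closedBall (T : H →L[ℝ] F) (r : ℝ) :
    IsClosed (T '' Metric.closedBall 0 r) := by
  refine isClosed_iff_ultrafilter.mpr fun y l hly hl => ?_
  choose! x hx hTx using fun z (hz : z ∈ T '' Metric.closedBall 0 r) => hz
  obtain ⟨a, ha, hlim⟩ := exists_norm_le_forall_tendsto_inner (l := l) (x := x) (r := r) (by
    filter_upwards [hl] with z hz
    exact mem_closedBall_zero_iff.mp (hx z hz))
  refine ⟨a, mem_closedBall_zero_iff.mpr ha,
    (SeparatingDual.eq_iff_forall_dual_eq (R := ℝ)).mpr fun f => ?_⟩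
  let fT : H := (InnerProductSpace.toDual ℝ H).symm (f ∘L T)
  have hfT (z : H) : inner ℝ z fT = f (T z) := by
    rw [real_inner_comm, InnerProductSpace.toDual_symm_apply, ContinuousLinearMap.comp_apply]
  have hlim_Ta : Tendsto f l (𝓝 (f (T a))) := by
    rw [← hfT]
    refine (hlim fT).congr' ?_
    filter_upwards [hl] with z hz
    rw [hfT, hTx z hz]
  exact tendsto_nhds_unique hlim_Ta ((f.continuous.tendsto y).mono_left hly)

end HilbertSpace

theorem norm_toLp_sub_toLp_le {α F : Type*} [MeasurableSpace α] {μ : Measure α}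
    [IsFiniteMeasure μ] [NormedAddCommGroup F] {p : ENNReal} {f g : α → F} (hf : MemLp f p μ)
    (hg : MemLp g p μ) {C : ℝ} (hC : 0 ≤ C) (h : ∀ᵐ x ∂μ, ‖f x - g x‖ ≤ C) :
    ‖hf.toLp f - hg.toLp g‖ ≤ measureUnivNNReal μ ^ p.toReal⁻¹ * C := by
  rw [← MemLp.toLp_sub]
  refine Lp.norm_le_of_ae_bound hC ?_
  filter_upwards [h, (hf.sub hg).coeFn_toLp] with x hx hx'
  rw [hx']
  exact hx

section SquareIntegrable

variable {α F : Type*} [MeasurableSpace α] {μ : Measure α} [NormedAddCommGroup F]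
  [InnerProductSpace ℝ F]

theorem inner_toLp_right (z : Lp F 2 μ) {g : α → F} (hg : MemLp g 2 μ) :
    inner ℝ z (hg.toLp g) = ∫ x, inner ℝ (z x) (g x) ∂μ := by
  rw [L2.inner_def]
  refine integral_congr_ae ?_
  filter_upwards [hg.coeFn_toLp] with x hx
  rw [hx]

theorem inner_toLp_toLp {f g : α → F} (hf : MemLp f 2 μ) (hg : MemLp g 2 μ) :
    inner ℝ (hf.toLp f) (hg.toLp g) = ∫ x, inner ℝ (f x) (g x) ∂μ := by
  rw [inner_toLp_right]
  refine integral_congr_ae ?_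
  filter_upwards [hf.coeFn_toLp] with x hx
  rw [hx]

theorem norm_toLp_sq {g : α → F} (hg : MemLp g 2 μ) : ‖hg.toLp g‖ ^ 2 = ∫ x, ‖g x‖ ^ 2 ∂μ := by
  simp only [← real_inner_self_eq_norm_sq, inner_toLp_toLp]

end SquareIntegrable

section TestFunctions

variable {E F : Type*} [NormedAddCommGroup E] [NormedSpace ℝ E]
  [NormedAddCommGroup F] [NormedSpace ℝ F] {Ω : Opens E}

theorem contDiff_testFunction (w : 𝓓(Ω, F)) (n : ℕ) : ContDiff ℝ n w :=
  w.contDiff.of_le (by exact_mod_cast le_top)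

theorem differentiable_testFunction (w : 𝓓(Ω, F)) : Differentiable ℝ w :=
  (contDiff_testFunction w 1).differentiable one_ne_zero

theorem lineDerivOp_apply_eq_fderiv (w : 𝓓(Ω, F)) (e x : E) :
    (∂_{e} w) x = fderiv ℝ w x e :=
  TestFunction.lineDerivCLM_eq_fderivCLM.trans <|
    congr($(TestFunction.fderivCLM_apply_of_le w (𝕜 := ℝ) (k := ⊤) le_rfl) x e)

theorem testFunction_apply_eq_zero (w : 𝓓(Ω, F)) {x : E} (hx : x ∉ Ω) : w x = 0 :=
  image_eq_zero_of_notMem_tsupport fun h => hx (w.tsupport_subset h)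

variable [MeasurableSpace E]

theorem setIntegral_mul_testFunction (f : E → ℝ) (w : 𝓓(Ω, ℝ)) (μ : Measure E) :
    ∫ x in (Ω : Set E), f x * w x ∂μ = ∫ x, f x * w x ∂μ :=
  setIntegral_eq_integral_of_forall_compl_eq_zero fun x hx => by
    rw [testFunction_apply_eq_zero w hx, mul_zero]

variable [OpensMeasurableSpace E] {μ : Measure E}

theorem integrable_clm_apply_mul_testFunction {f : E → F} (hf : LocallyIntegrableOn f Ω μ)
    (L : F →L[ℝ] ℝ) (w : 𝓓(Ω, ℝ)) : Integrable (fun x => L (f x) * w x) μ := by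
  simpa [mul_comm] using w.integrable_bilin (ContinuousLinearMap.toSpanSingleton ℝ L) hf

theorem integrable_mul_testFunction {f : E → ℝ} (hf : LocallyIntegrableOn f Ω μ) (w : 𝓓(Ω, ℝ)) :
    Integrable (fun x => f x * w x) μ :=
  integrable_clm_apply_mul_testFunction hf (.id ℝ ℝ) w

theorem memLp_testFunction [IsFiniteMeasureOnCompacts μ] (w : 𝓓(Ω, F)) (p : ENNReal) :
    MemLp w p μ :=
  w.continuous.memLp_of_hasCompactSupport w.hasCompactSupport

/-- The inclusion of the test functions in `Lᵖ(μ)`. -/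
noncomputable def testToLp (p : ENNReal) (μ : Measure E) [IsFiniteMeasureOnCompacts μ] :
    𝓓(Ω, F) →ₗ[ℝ] Lp F p μ where
  toFun w := (memLp_testFunction w p).toLp w
  map_add' _ _ := MemLp.toLp_add _ _
  map_smul' _ _ := MemLp.toLp_const_smul _ _

theorem tendsto_testToLp_iff {ι : Type*} [IsFiniteMeasureOnCompacts μ] {p : ENNReal}
    [Fact (1 ≤ p)] {l : Filter ι} {w : ι → 𝓓(Ω, F)} {f : E → F} (hf : MemLp f p μ) :
    Tendsto (fun i => testToLp p μ (w i)) l (𝓝 (hf.toLp f)) ↔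
      Tendsto (fun i => eLpNorm (fun x => f x - w i x) p μ) l (𝓝 0) :=
  (Lp.tendsto_Lp_iff_tendsto_eLpNorm'' _ (fun i => memLp_testFunction (w i) p) f hf).trans <| by
    simp only [eLpNorm_sub_comm _ f]
    rfl

end TestFunctions

section TestGradient

variable {E F : Type*} [NormedAddCommGroup E] [InnerProductSpace ℝ E] [FiniteDimensional ℝ E]
  [NormedAddCommGroup F] [NormedSpace ℝ F] {Ω : Opens E}

theorem laplacian_eq_sum_fderiv {ι : Type*} [Fintype ι] (b : OrthonormalBasis ι ℝ E)
    {f : E → F} {x : E} (hf : ContDiffAt ℝ 2 f x) :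
    (Δ f) x = ∑ i, fderiv ℝ (fun y => fderiv ℝ f y (b i)) x (b i) := by
  have hf' : DifferentiableAt ℝ (fderiv ℝ f) x :=
    (hf.fderiv_right (m := 1) (by norm_num)).differentiableAt one_ne_zero
  rw [InnerProductSpace.laplacian_eq_iteratedFDeriv_orthonormalBasis f b]
  refine Finset.sum_congr rfl fun i _ => ?_
  rw [iteratedFDeriv_two_apply, fderiv_clm_apply hf' (differentiableAt_const _)]
  simp

theorem laplacian_testFunction {ι : Type*} [Fintype ι] (b : OrthonormalBasis ι ℝ E)
    (w : 𝓓(Ω, F)) : Δ (w : E → F) = (∑ i, ∂_{b i} (∂_{b i} w) : 𝓓(Ω, F)) := by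
  ext x
  rw [laplacian_eq_sum_fderiv b (contDiff_testFunction w 2).contDiffAt]
  simp only [lineDerivOp_apply_eq_fderiv, ← funext (lineDerivOp_apply_eq_fderiv w _),
    FunLike.coe_sum, Finset.sum_apply]

theorem tsupport_gradient_subset (f : E → ℝ) : tsupport (∇ f) ⊆ tsupport f :=
  (closure_mono fun x hx => by simpa [gradient] using hx).trans (tsupport_fderiv_subset ℝ)

theorem contDiff_gradient {f : E → ℝ} {n m : WithTop ℕ∞} (hf : ContDiff ℝ n f) (hmn : m + 1 ≤ n) :
    ContDiff ℝ m (∇ f) :=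
  (InnerProductSpace.toDual ℝ E).symm.toContinuousLinearEquiv.contDiff.comp (hf.fderiv_right hmn)

/-- The gradient of a test function, as a vector-valued test function. -/
noncomputable def testGradient : 𝓓(Ω, ℝ) →ₗ[ℝ] 𝓓(Ω, E) where
  toFun w := ⟨∇ w, contDiff_gradient w.contDiff le_rfl,
    w.hasCompactSupport.of_isClosed_subset (isClosed_tsupport _) (tsupport_gradient_subset _),
    (tsupport_gradient_subset _).trans w.tsupport_subset⟩
  map_add' w q := by
    ext x
    have h := fderiv_add (differentiable_testFunction w x) (differentiable_testFunction q x)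
    change ∇ ⇑(w + q) x = ∇ w x + ∇ q x
    simp only [gradient, FunLike.coe_add, h, map_add]
  map_smul' c w := by
    ext x
    have h := fderiv_const_smul (differentiable_testFunction w x) c
    change ∇ ⇑(c • w) x = c • ∇ w x
    simp only [gradient, FunLike.coe_smul, h, map_smul]

theorem coe_testGradient (w : 𝓓(Ω, ℝ)) : testGradient w = ∇ (w : E → ℝ) := rfl

theorem inner_testGradient (w : 𝓓(Ω, ℝ)) (x e : E) :
    inner ℝ e (testGradient w x) = (∂_{e} w) x := by
  rw [lineDerivOp_apply_eq_fderiv, coe_testGradient, inner_gradient_right]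
  rfl

end TestGradient

section WeakGradient

variable {E : Type*} [NormedAddCommGroup E] [InnerProductSpace ℝ E] [FiniteDimensional ℝ E]
  [MeasurableSpace E] [BorelSpace E] {Ω : Opens E}

/-- `G` is the weak gradient of `v` on `Ω`, tested in all directions instead of along a basis. -/
def IsWeakGradient (Ω : Opens E) (v : E → ℝ) (G : E → E) : Prop :=
  ∀ (w : 𝓓(Ω, ℝ)) (e : E),
    ∫ x in (Ω : Set E), v x * (∂_{e} w) x = -∫ x in (Ω : Set E), inner ℝ e (G x) * w x

theorem setIntegral_mul_lineDerivOp {f : E → ℝ} (hf : ContDiffOn ℝ 1 f Ω) (w : 𝓓(Ω, ℝ)) (e : E) :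
    ∫ x in (Ω : Set E), f x * (∂_{e} w) x = -∫ x in (Ω : Set E), fderiv ℝ f x e * w x := by
  have hf' : ContinuousOn (fun x => fderiv ℝ f x e) Ω :=
    (hf.continuousOn_fderiv_of_isOpen Ω.isOpen le_rfl).clm_apply continuousOn_const
  have hmeas : MeasurableSet (Ω : Set E) := Ω.isOpen.measurableSet
  rw [setIntegral_mul_testFunction, setIntegral_mul_testFunction]
  simp only [lineDerivOp_apply_eq_fderiv]
  refine integral_mul_fderiv_eq_neg_fderiv_mul_of_integrable
    (integrable_mul_testFunction (hf'.locallyIntegrableOn hmeas) w) ?_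
    (integrable_mul_testFunction (hf.continuousOn.locallyIntegrableOn hmeas) w)
    (fun x hx => (hf.differentiableOn one_ne_zero).differentiableAt
      (Ω.isOpen.mem_nhds (w.tsupport_subset hx)))
    (fun x _ => differentiable_testFunction w x)
  simpa only [lineDerivOp_apply_eq_fderiv] using
    integrable_mul_testFunction (hf.continuousOn.locallyIntegrableOn hmeas) (∂_{e} w)

theorem isWeakGradient_gradient {f : E → ℝ} (hf : ContDiffOn ℝ 1 f Ω) :
    IsWeakGradient Ω f (∇ f) := fun w e => by
  simpa only [inner_gradient_right, conj_trivial] using setIntegral_mul_lineDerivOp hf w e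

theorem IsWeakGradient.setIntegral_mul_laplacian {v : E → ℝ} {G : E → E}
    (h : IsWeakGradient Ω v G) (hv : LocallyIntegrableOn v Ω) (hG : LocallyIntegrableOn G Ω)
    (w : 𝓓(Ω, ℝ)) :
    ∫ x in (Ω : Set E), v x * (Δ (w : E → ℝ)) x
      = -∫ x in (Ω : Set E), inner ℝ (G x) (∇ w x) := by
  let b := stdOrthonormalBasis ℝ E
  have hinner (x : E) : inner ℝ (G x) (∇ w x) = ∑ i, inner ℝ (b i) (G x) * (∂_{b i} w) x := by
    rw [← b.sum_inner_mul_inner]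
    refine Finset.sum_congr rfl fun i _ => ?_
    rw [← coe_testGradient, inner_testGradient, real_inner_comm]
  have hintegrable (i) : IntegrableOn (fun x => inner ℝ (b i) (G x) * (∂_{b i} w) x) Ω :=
    (integrable_clm_apply_mul_testFunction hG (innerSL ℝ (b i)) _).integrableOn
  simp only [hinner, laplacian_testFunction b, FunLike.coe_sum, Finset.sum_apply, Finset.mul_sum]
  rw [integral_finsetSum _ fun i _ => (integrable_mul_testFunction hv _).integrableOn,
    integral_finsetSum _ fun i _ => hintegrable i,
    ← Finset.sum_neg_distrib]
  exact Finset.sum_congr rfl fun i _ => h _ _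

theorem setIntegral_mul_laplacian_eq_integral (f : E → ℝ) (w : 𝓓(Ω, ℝ)) :
    ∫ x in (Ω : Set E), f x * (Δ (w : E → ℝ)) x = ∫ x, f x * (Δ (w : E → ℝ)) x := by
  rw [laplacian_testFunction (stdOrthonormalBasis ℝ E), setIntegral_mul_testFunction]

theorem setIntegral_mul_laplacian_comm {f : E → ℝ} (hf : ContDiffOn ℝ 2 f Ω) (w : 𝓓(Ω, ℝ)) :
    ∫ x in (Ω : Set E), f x * (Δ (w : E → ℝ)) x = ∫ x in (Ω : Set E), (Δ f) x * w x := by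
  let b := stdOrthonormalBasis ℝ E
  have hmeas : MeasurableSet (Ω : Set E) := Ω.isOpen.measurableSet
  have hf' (i) : ContDiffOn ℝ 1 (fun x => fderiv ℝ f x (b i)) Ω :=
    (hf.fderiv_of_isOpen Ω.isOpen (by norm_num)).clm_apply contDiffOn_const
  have hf'' (i) : ContinuousOn (fun x => fderiv ℝ (fun y => fderiv ℝ f y (b i)) x (b i)) Ω :=
    ((hf' i).continuousOn_fderiv_of_isOpen Ω.isOpen le_rfl).clm_apply continuousOn_const
  have hlaplacian : ∫ x in (Ω : Set E), (Δ f) x * w x = ∫ x in (Ω : Set E),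
      ∑ i, fderiv ℝ (fun y => fderiv ℝ f y (b i)) x (b i) * w x :=
    setIntegral_congr_fun hmeas fun x hx => by
      rw [laplacian_eq_sum_fderiv b (hf.contDiffAt (Ω.isOpen.mem_nhds hx)), Finset.sum_mul]
  simp only [hlaplacian, laplacian_testFunction b, FunLike.coe_sum, Finset.sum_apply,
    Finset.mul_sum]
  rw [integral_finsetSum _ fun i _ => (integrable_mul_testFunction
      (hf.continuousOn.locallyIntegrableOn hmeas) _).integrableOn,
    integral_finsetSum _ fun i _ => (integrable_mul_testFunction
      ((hf'' i).locallyIntegrableOn hmeas) _).integrableOn]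
  refine Finset.sum_congr rfl fun i _ => ?_
  rw [setIntegral_mul_lineDerivOp (hf.of_le one_le_two), setIntegral_mul_lineDerivOp (hf' i),
    neg_neg]

theorem setIntegral_mul_laplacian_eq_zero_of_harmonicOnNhd {f : E → ℝ}
    (hf : InnerProductSpace.HarmonicOnNhd f Ω) (w : 𝓓(Ω, ℝ)) :
    ∫ x in (Ω : Set E), f x * (Δ (w : E → ℝ)) x = 0 := by
  rw [setIntegral_mul_laplacian_comm hf.contDiffOn]
  refine setIntegral_eq_zero_of_forall_eq_zero fun x hx => ?_
  rw [(hf x hx).2.eq_of_nhds, Pi.zero_apply, zero_mul]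

theorem setIntegral_sub_mul_laplacian_of_harmonicOnNhd {f u : E → ℝ} (hf : ContinuousOn f Ω)
    (hu : InnerProductSpace.HarmonicOnNhd u Ω) (w : 𝓓(Ω, ℝ)) :
    ∫ x in (Ω : Set E), (f x - u x) * (Δ (w : E → ℝ)) x
      = ∫ x in (Ω : Set E), f x * (Δ (w : E → ℝ)) x := by
  have hint {g : E → ℝ} (hg : ContinuousOn g Ω) :
      IntegrableOn (fun x => g x * (Δ (w : E → ℝ)) x) Ω := by
    rw [laplacian_testFunction (stdOrthonormalBasis ℝ _)]
    exact (integrable_mul_testFunction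
      (hg.locallyIntegrableOn Ω.isOpen.measurableSet) _).integrableOn
  simp only [sub_mul]
  rw [integral_sub (hint hf) (hint hu.contDiffOn.continuousOn),
    setIntegral_mul_laplacian_eq_zero_of_harmonicOnNhd hu, sub_zero]

end WeakGradient

section Poincare

variable {E : Type*} [NormedAddCommGroup E] [InnerProductSpace ℝ E] [FiniteDimensional ℝ E]
  [MeasurableSpace E] [BorelSpace E] {Ω : Opens E}

theorem setIntegral_sq_eq_neg_two_mul {e : E} (he : ‖e‖ = 1) (w : 𝓓(Ω, ℝ)) :
    ∫ x in (Ω : Set E), w x ^ 2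
      = -2 * ∫ x in (Ω : Set E), inner ℝ e x * w x * (∂_{e} w) x := by
  have hsmooth : ContDiffOn ℝ 1 (fun x => inner ℝ e x * w x) Ω :=
    ((innerSL ℝ e).contDiff.mul (contDiff_testFunction w 1)).contDiffOn
  have hderiv (x : E) :
      fderiv ℝ (fun x => inner ℝ e x * w x) x e = inner ℝ e x * (∂_{e} w) x + w x := by
    have h := ((innerSL ℝ e).hasFDerivAt (x := x)).mul (differentiable_testFunction w x).hasFDerivAt
    refine congr($(h.fderiv) e).trans ?_
    simp [he, lineDerivOp_apply_eq_fderiv]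
  have hint : IntegrableOn (fun x => inner ℝ e x * w x * (∂_{e} w) x) Ω :=
    (integrable_mul_testFunction
      (hsmooth.continuousOn.locallyIntegrableOn Ω.isOpen.measurableSet) _).integrableOn
  have hparts := setIntegral_mul_lineDerivOp hsmooth w e
  have hsplit : ∫ x in (Ω : Set E), fderiv ℝ (fun x => inner ℝ e x * w x) x e * w x
      = (∫ x in (Ω : Set E), inner ℝ e x * w x * (∂_{e} w) x) + ∫ x in (Ω : Set E), w x ^ 2 := by
    rw [← integral_add hint ((memLp_testFunction w 2).integrable_sq.integrableOn)]
    refine integral_congr_ae (ae_of_all _ fun x => ?_)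
    beta_reduce
    rw [hderiv]
    ring
  linarith

theorem setIntegral_sq_le_mul_setIntegral_lineDerivOp_sq {R : ℝ} (hR : ∀ x ∈ Ω, ‖x‖ ≤ R) {e : E}
    (he : ‖e‖ = 1) (w : 𝓓(Ω, ℝ)) :
    ∫ x in (Ω : Set E), w x ^ 2 ≤ (2 * R) ^ 2 * ∫ x in (Ω : Set E), (∂_{e} w) x ^ 2 := by
  have hint_sq (q : 𝓓(Ω, ℝ)) : IntegrableOn (fun x => q x ^ 2) Ω :=
    (memLp_testFunction q 2).integrable_sq.integrableOn
  have hamgm (x : E) (hx : x ∈ Ω) : -2 * (inner ℝ e x * w x * (∂_{e} w) x)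
      ≤ 1 / 2 * w x ^ 2 + 2 * R ^ 2 * (∂_{e} w) x ^ 2 := by
    have hinner : |inner ℝ e x| ≤ R := by
      simpa [he] using (abs_real_inner_le_norm e x).trans
        (mul_le_mul_of_nonneg_left (hR x hx) (norm_nonneg e))
    have hsq := mul_le_mul_of_nonneg_right (sq_le_sq' (abs_le.mp hinner).1 (abs_le.mp hinner).2)
      (sq_nonneg ((∂_{e} w) x))
    linarith [sq_nonneg (w x + 2 * (inner ℝ e x * (∂_{e} w) x))]
  have hcont : Continuous fun x => inner ℝ e x * w x :=
    (continuous_const.inner continuous_id).mul w.continuous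
  have hint_mul : IntegrableOn (fun x => inner ℝ e x * w x * (∂_{e} w) x) Ω :=
    (integrable_mul_testFunction
      (hcont.continuousOn.locallyIntegrableOn Ω.isOpen.measurableSet) _).integrableOn
  have hle : ∫ x in (Ω : Set E), -2 * (inner ℝ e x * w x * (∂_{e} w) x)
      ≤ ∫ x in (Ω : Set E), (1 / 2 * w x ^ 2 + 2 * R ^ 2 * (∂_{e} w) x ^ 2) :=
    setIntegral_mono_on (hint_mul.const_mul _) (((hint_sq w).const_mul _).add
      ((hint_sq _).const_mul _)) Ω.isOpen.measurableSet hamgm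
  rw [integral_const_mul, ← setIntegral_sq_eq_neg_two_mul he w,
    integral_add ((hint_sq w).const_mul _) ((hint_sq _).const_mul _), integral_const_mul,
    integral_const_mul] at hle
  linarith

end Poincare

section SobolevSpace

variable {E : Type*} [NormedAddCommGroup E] [InnerProductSpace ℝ E] [FiniteDimensional ℝ E]
  [MeasurableSpace E] [BorelSpace E] {Ω : Opens E}

/-- The Hilbert space `L²(Ω) × L²(Ω; E)` containing `H¹(Ω)`: a Sobolev function is encoded as the
pair formed by itself and its weak gradient. -/
abbrev L2Pair (Ω : Opens E) : Type _ :=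
  WithLp 2 (Lp ℝ 2 (volume.restrict (Ω : Set E)) × Lp E 2 (volume.restrict (Ω : Set E)))

/-- The embedding `w ↦ (w, ∇w)`, whose norm is the `H¹(Ω)` norm. -/
noncomputable def testToH1 : 𝓓(Ω, ℝ) →ₗ[ℝ] L2Pair Ω :=
  (WithLp.linearEquiv 2 ℝ _).symm.toLinearMap ∘ₗ
    (testToLp 2 (volume.restrict (Ω : Set E))).prod (testToLp 2 _ ∘ₗ testGradient)

theorem snd_testToH1 (w : 𝓓(Ω, ℝ)) : (testToH1 w).snd = testToLp 2 _ (testGradient w) := rfl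

theorem norm_fst_testToH1_sq (w : 𝓓(Ω, ℝ)) :
    ‖(testToH1 w).fst‖ ^ 2 = ∫ x in (Ω : Set E), w x ^ 2 :=
  (norm_toLp_sq (memLp_testFunction w 2)).trans (by simp only [Real.norm_eq_abs, sq_abs])

theorem norm_snd_testToH1_sq (w : 𝓓(Ω, ℝ)) :
    ‖(testToH1 w).snd‖ ^ 2 = ∫ x in (Ω : Set E), ‖∇ w x‖ ^ 2 :=
  norm_toLp_sq (memLp_testFunction (testGradient w) 2)

theorem norm_testToH1_sq (w : 𝓓(Ω, ℝ)) : ‖testToH1 w‖ ^ 2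
    = (∫ x in (Ω : Set E), w x ^ 2) + ∫ x in (Ω : Set E), ‖∇ w x‖ ^ 2 := by
  rw [WithLp.prod_norm_sq_eq_of_L2, norm_fst_testToH1_sq, norm_snd_testToH1_sq]

end SobolevSpace

section SobolevH10

variable {E : Type*} [NormedAddCommGroup E] [InnerProductSpace ℝ E] [FiniteDimensional ℝ E]
  [MeasurableSpace E] [BorelSpace E] {Ω : Opens E}

theorem IsWeakGradient.congr_ae {v v' : E → ℝ} {G G' : E → E} (h : IsWeakGradient Ω v G)
    (hv : v =ᵐ[volume.restrict (Ω : Set E)] v') (hG : G =ᵐ[volume.restrict (Ω : Set E)] G') :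
    IsWeakGradient Ω v' G' := by
  intro w e
  have hleft : (fun x => v x * (∂_{e} w) x) =ᵐ[volume.restrict (Ω : Set E)]
      fun x => v' x * (∂_{e} w) x := by
    filter_upwards [hv] with x hx
    rw [hx]
  have hright : (fun x => inner ℝ e (G x) * w x) =ᵐ[volume.restrict (Ω : Set E)]
      fun x => inner ℝ e (G' x) * w x := by
    filter_upwards [hG] with x hx
    rw [hx]
  rw [← integral_congr_ae hleft, ← integral_congr_ae hright, h w e]

/-- `H¹₀(Ω)`, as a closed subspace of `L²(Ω) × L²(Ω; E)`. -/
noncomputable def sobolevH10 (Ω : Opens E) : Submodule ℝ (L2Pair Ω) :=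
  (LinearMap.range testToH1).topologicalClosure

theorem testToH1_mem_sobolevH10 (w : 𝓓(Ω, ℝ)) : testToH1 w ∈ sobolevH10 Ω :=
  Submodule.le_topologicalClosure _ ⟨w, rfl⟩

theorem sobolevH10_induction {p : L2Pair Ω → Prop} (hp : IsClosed {z | p z})
    (htest : ∀ w : 𝓓(Ω, ℝ), p (testToH1 w)) {z : L2Pair Ω} (hz : z ∈ sobolevH10 Ω) : p z :=
  closure_minimal (Set.range_subset_iff.mpr htest) hp hz

theorem isWeakGradient_of_mem_sobolevH10 {z : L2Pair Ω} (hz : z ∈ sobolevH10 Ω) :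
    IsWeakGradient Ω z.fst z.snd := by
  intro w e
  let we : 𝓓(Ω, E) := TestFunction.postcompCLM (ContinuousLinearMap.toSpanSingleton ℝ e) w
  have hwe (x : E) : we x = w x • e := rfl
  have hfst (y : L2Pair Ω) : ∫ x in (Ω : Set E), y.fst x * (∂_{e} w) x
      = inner ℝ y.fst (testToLp 2 _ (∂_{e} w)) := by
    refine Eq.trans ?_ (inner_toLp_right y.fst (memLp_testFunction _ 2)).symm
    simp [mul_comm]
  have hsnd (y : L2Pair Ω) : ∫ x in (Ω : Set E), inner ℝ e (y.snd x) * w x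
      = inner ℝ y.snd (testToLp 2 _ we) := by
    refine Eq.trans ?_ (inner_toLp_right y.snd (memLp_testFunction we 2)).symm
    simp [hwe, real_inner_smul_right, real_inner_comm, mul_comm]
  rw [hfst, hsnd]
  refine sobolevH10_induction (p := fun y => inner ℝ y.fst (testToLp 2 _ (∂_{e} w))
    = -inner ℝ y.snd (testToLp 2 _ we)) (isClosed_eq (by fun_prop) (by fun_prop)) (fun q => ?_) hz
  rw [← hfst, ← hsnd]
  exact (isWeakGradient_gradient (contDiff_testFunction q 1).contDiffOn).congr_ae
    (memLp_testFunction q 2).coeFn_toLp.symm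
    (memLp_testFunction (testGradient q) 2).coeFn_toLp.symm w e

theorem norm_fst_sq_le_mul_norm_snd_sq [Nontrivial E] {R : ℝ} (hR : ∀ x ∈ Ω, ‖x‖ ≤ R)
    {z : L2Pair Ω} (hz : z ∈ sobolevH10 Ω) : ‖z.fst‖ ^ 2 ≤ (2 * R) ^ 2 * ‖z.snd‖ ^ 2 := by
  obtain ⟨e, he⟩ := exists_norm_eq E zero_le_one
  refine sobolevH10_induction (p := fun y => ‖y.fst‖ ^ 2 ≤ (2 * R) ^ 2 * ‖y.snd‖ ^ 2)
    (isClosed_le (by fun_prop) (by fun_prop)) (fun w => ?_) hz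
  rw [norm_fst_testToH1_sq, norm_snd_testToH1_sq]
  refine (setIntegral_sq_le_mul_setIntegral_lineDerivOp_sq hR he w).trans ?_
  gcongr ?_ * ?_
  refine setIntegral_mono (memLp_testFunction _ 2).integrable_sq.integrableOn
    ((memLp_testFunction (testGradient w) 2).integrable_norm_pow two_ne_zero).integrableOn
    fun x => sq_le_sq.mpr ?_
  rw [abs_norm, ← inner_testGradient, ← coe_testGradient]
  simpa only [he, one_mul] using abs_real_inner_le_norm e (testGradient w x)

theorem eq_of_inner_snd_testGradient_eq [Nontrivial E] (hΩ : Bornology.IsBounded (Ω : Set E))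
    {z z' : L2Pair Ω} (hz : z ∈ sobolevH10 Ω) (hz' : z' ∈ sobolevH10 Ω)
    (h : ∀ w : 𝓓(Ω, ℝ), inner ℝ z.snd (testToLp 2 _ (testGradient w))
      = inner ℝ z'.snd (testToLp 2 _ (testGradient w))) : z = z' := by
  obtain ⟨R, hR⟩ := hΩ.exists_norm_le
  have hsub : z - z' ∈ sobolevH10 Ω := sub_mem hz hz'
  have horth : inner ℝ (z - z').snd (z - z').snd = (0 : ℝ) :=
    sobolevH10_induction (p := fun y => inner ℝ (z - z').snd y.snd = (0 : ℝ))
      (isClosed_eq (by fun_prop) continuous_const)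
      (fun w => by rw [snd_testToH1, WithLp.sub_snd, inner_sub_left, h w, sub_self]) hsub
  have hsnd : (z - z').snd = 0 := inner_self_eq_zero.mp horth
  have hfst : (z - z').fst = 0 := by
    simpa [hsnd, sq_nonpos_iff] using norm_fst_sq_le_mul_norm_snd_sq hR hsub
  exact sub_eq_zero.mp (WithLp.ofLp_injective 2 (Prod.ext hfst hsnd))

end SobolevH10

section SoftThreshold

/-- A smooth soft threshold: a nondecreasing `1`-Lipschitz function which vanishes on
`[-b.rIn, b.rIn]` and stays within `2 * b.rOut` of the identity. -/
noncomputable def softThreshold (b : ContDiffBump (0 : ℝ)) (t : ℝ) : ℝ :=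
  ∫ s in (0 : ℝ)..t, (1 - b s)

variable (b : ContDiffBump (0 : ℝ))

theorem hasDerivAt_softThreshold (t : ℝ) : HasDerivAt (softThreshold b) (1 - b t) t :=
  ((continuous_const.sub b.continuous).integral_hasStrictDerivAt 0 t).hasDerivAt

theorem contDiff_softThreshold : ContDiff ℝ (⊤ : ℕ∞) (softThreshold b) := by
  refine contDiff_infty_iff_deriv.mpr
    ⟨fun t => (hasDerivAt_softThreshold b t).differentiableAt, ?_⟩
  rw [deriv_eq fun t => hasDerivAt_softThreshold b t]
  exact contDiff_const.sub b.contDiff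

theorem softThreshold_eq_zero {t : ℝ} (ht : |t| ≤ b.rIn) : softThreshold b t = 0 := by
  refine (intervalIntegral.integral_congr (g := fun _ => (0 : ℝ)) fun s hs => ?_).trans
    intervalIntegral.integral_zero
  have hst : |s| ≤ |t| := by simpa only [sub_zero] using Set.abs_sub_left_of_mem_uIcc hs
  exact sub_eq_zero.mpr
    (b.one_of_mem_closedBall (mem_closedBall_zero_iff.mpr (hst.trans ht))).symm

theorem abs_softThreshold_sub_le (t : ℝ) : |softThreshold b t - t| ≤ 2 * b.rOut := by
  have hsub : softThreshold b t - t = -∫ s in (0 : ℝ)..t, b s := by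
    rw [softThreshold, intervalIntegral.integral_sub intervalIntegrable_const
      (b.continuous.intervalIntegrable _ _)]
    simp
  rw [hsub, abs_neg]
  calc ‖∫ s in (0 : ℝ)..t, b s‖
      ≤ ∫ s in Set.uIoc 0 t, ‖b s‖ := intervalIntegral.norm_integral_le_integral_norm_uIoc
    _ ≤ ∫ s, ‖b s‖ := setIntegral_le_integral b.integrable.norm (ae_of_all _ fun _ => norm_nonneg _)
    _ = ∫ s, b s := by simp only [Real.norm_of_nonneg b.nonneg]
    _ ≤ volume.real (Metric.closedBall (0 : ℝ) b.rOut) := b.integral_le_measure_closedBall volume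
    _ = 2 * b.rOut := Real.volume_real_closedBall b.rOut_pos.le

theorem tsupport_softThreshold_comp_subset {X : Type*} [TopologicalSpace X] {f v : X → ℝ}
    (hv : Continuous v) {η : ℝ} (hfv : ∀ x, |f x - v x| ≤ η) :
    tsupport (fun x => softThreshold b (f x)) ⊆ {x | b.rIn - η ≤ |v x|} := by
  refine closure_minimal (fun x hx => ?_) (isClosed_le continuous_const hv.abs)
  by_contra hlt
  rw [Set.mem_ofPred_eq, not_le] at hlt
  refine hx (softThreshold_eq_zero b ?_)
  linarith [abs_sub_abs_le_abs_sub (f x) (v x), hfv x]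

end SoftThreshold

section Energy

variable {E : Type*} [NormedAddCommGroup E] [InnerProductSpace ℝ E] [FiniteDimensional ℝ E]
  [MeasurableSpace E] [BorelSpace E] {Ω : Opens E}

theorem setIntegral_norm_gradient_comp_sq_le {f : E → ℝ} (hf : ContDiff ℝ 1 f) {F F' : ℝ → ℝ}
    (hF : ∀ t, HasDerivAt F (F' t) t) (hF' : ∀ t, F' t ∈ Set.Icc 0 1) {w : 𝓓(Ω, ℝ)}
    (hw : ∀ x, w x = F (f x)) :
    ∫ x in (Ω : Set E), ‖∇ w x‖ ^ 2 ≤ -∫ x in (Ω : Set E), f x * (Δ (w : E → ℝ)) x := by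
  have hmeas : MeasurableSet (Ω : Set E) := Ω.isOpen.measurableSet
  have hgrad (x : E) : ∇ w x = F' (f x) • ∇ f x := by
    have h := (hF (f x)).comp_hasFDerivAt x (hf.differentiable one_ne_zero x).hasFDerivAt
    rw [show (w : E → ℝ) = F ∘ f from funext hw, gradient, h.fderiv, map_smul, gradient]
  have hle (x : E) : ‖∇ w x‖ ^ 2 ≤ inner ℝ (∇ f x) (∇ w x) := by
    obtain ⟨h0, h1⟩ := hF' (f x)
    rw [hgrad, norm_smul, real_inner_smul_right, real_inner_self_eq_norm_sq, mul_pow,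
      Real.norm_eq_abs, sq_abs]
    exact mul_le_mul_of_nonneg_right (pow_le_of_le_one h0 h1 two_ne_zero) (sq_nonneg _)
  have hf' : Continuous (∇ f) := (contDiff_gradient (m := 0) hf le_rfl).continuous
  rw [(isWeakGradient_gradient hf.contDiffOn).setIntegral_mul_laplacian
    (hf.continuous.continuousOn.locallyIntegrableOn hmeas)
    (hf'.continuousOn.locallyIntegrableOn hmeas), neg_neg]
  refine setIntegral_mono
    ((memLp_testFunction (testGradient w) 2).integrable_norm_pow two_ne_zero).integrableOn
    (Integrable.integrableOn ?_) hle
  refine (hf'.inner (testGradient w).continuous).integrable_of_hasCompactSupport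
    ((testGradient w).hasCompactSupport.mono fun x hx h => hx ?_)
  beta_reduce
  rw [← coe_testGradient, h, inner_zero_right]

end Energy

section Translation

variable {E : Type*} [NormedAddCommGroup E] [InnerProductSpace ℝ E] {Ω : Opens E}

theorem laplacian_comp_add_right [FiniteDimensional ℝ E] {F : Type*} [NormedAddCommGroup F]
    [NormedSpace ℝ F] (g : E → F) (y x : E) : (Δ fun z => g (z + y)) x = (Δ g) (x + y) := by
  simp only [InnerProductSpace.laplacian_eq_iteratedFDeriv_stdOrthonormalBasis,
    iteratedFDeriv_comp_add_right]

theorem gradient_comp_add_right [CompleteSpace E] (g : E → ℝ) (y x : E) :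
    ∇ (fun z => g (z + y)) x = ∇ g (x + y) := by
  simp only [gradient, fderiv_comp_add_right]

/-- The translate `x ↦ w (x + y)`, which is a test function on `Ω` if its support stays in `Ω`. -/
noncomputable def testTranslate (w : 𝓓(Ω, ℝ)) (y : E) (hy : (· + y) ⁻¹' tsupport w ⊆ Ω) :
    𝓓(Ω, ℝ) where
  toFun x := w (x + y)
  contDiff' := w.contDiff.comp (contDiff_id.add contDiff_const)
  hasCompactSupport' := w.hasCompactSupport.comp_homeomorph (Homeomorph.addRight y)
  tsupport_subset' := (tsupport_comp_eq_preimage w (Homeomorph.addRight y)).trans_subset hy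

theorem coe_testTranslate (w : 𝓓(Ω, ℝ)) {y : E} (hy : (· + y) ⁻¹' tsupport w ⊆ Ω) :
    testTranslate w y hy = fun x => w (x + y) := rfl

end Translation

section Mollification

variable {E : Type*} [NormedAddCommGroup E] [InnerProductSpace ℝ E] [FiniteDimensional ℝ E]
  [MeasurableSpace E] [BorelSpace E] {Ω : Opens E}

theorem norm_testToH1_testTranslate (w : 𝓓(Ω, ℝ)) {y : E} (hy : (· + y) ⁻¹' tsupport w ⊆ Ω) :
    ‖testToH1 (testTranslate w y hy)‖ = ‖testToH1 w‖ := by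
  have hnorm (q : 𝓓(Ω, ℝ)) : ‖testToH1 q‖ ^ 2 = (∫ x, q x ^ 2) + ∫ x, ‖∇ q x‖ ^ 2 := by
    rw [norm_testToH1_sq]
    congr 1 <;> refine setIntegral_eq_integral_of_forall_compl_eq_zero fun x hx => ?_
    · rw [testFunction_apply_eq_zero q hx, zero_pow two_ne_zero]
    · rw [← coe_testGradient, testFunction_apply_eq_zero _ hx, norm_zero, zero_pow two_ne_zero]
  refine (sq_eq_sq₀ (norm_nonneg _) (norm_nonneg _)).mp ?_
  simp only [hnorm, coe_testTranslate, gradient_comp_add_right]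
  rw [integral_add_right_eq_self fun x => w x ^ 2, integral_add_right_eq_self fun x => ‖∇ w x‖ ^ 2]

theorem integral_convolution_mul {G : Type*} [NormedAddCommGroup G] [MeasurableSpace G]
    [BorelSpace G] {μ : Measure G} [μ.IsAddRightInvariant] [IsFiniteMeasureOnCompacts μ]
    {ρ v g : G → ℝ} (hρ : Continuous ρ) (hρc : HasCompactSupport ρ) (hv : Continuous v)
    (hg : Continuous g) (hgc : HasCompactSupport g) :
    ∫ x, (ρ ⋆[.lsmul ℝ ℝ, μ] v) x * g x ∂μ = ∫ y, ρ y * ∫ x, v x * g (x + y) ∂μ ∂μ := by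
  have hswap : ∫ x, ∫ y, ρ y * v (x - y) * g x ∂μ ∂μ = ∫ y, ∫ x, ρ y * v (x - y) * g x ∂μ ∂μ := by
    refine integral_integral_swap_of_hasCompactSupport (by fun_prop)
      (HasCompactSupport.intro (hgc.prod hρc) fun ⟨x, y⟩ hxy => ?_)
    rcases not_and_or.mp hxy with hx | hy
    · exact mul_eq_zero_of_right _ (image_eq_zero_of_notMem_tsupport hx)
    · exact mul_eq_zero_of_left (mul_eq_zero_of_left (image_eq_zero_of_notMem_tsupport hy) _) _
  simp only [convolution_lsmul, smul_eq_mul, ← integral_mul_const, hswap]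
  refine integral_congr_ae (ae_of_all _ fun y => ?_)
  beta_reduce
  rw [← integral_sub_right_eq_self (fun x => v x * g (x + y)) y, ← integral_const_mul]
  simp only [sub_add_cancel, mul_assoc]

theorem abs_setIntegral_convolution_mul_laplacian_le {v : E → ℝ} (hv : Continuous v) {M : ℝ}
    (hM : ∀ w : 𝓓(Ω, ℝ), |∫ x in (Ω : Set E), v x * (Δ (w : E → ℝ)) x| ≤ M * ‖testToH1 w‖)
    (φ : ContDiffBump (0 : E)) (w : 𝓓(Ω, ℝ))
    (hφ : Metric.cthickening φ.rOut (tsupport w) ⊆ Ω) :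
    |∫ x in (Ω : Set E), (φ.normed volume ⋆[.lsmul ℝ ℝ, volume] v) x * (Δ (w : E → ℝ)) x|
      ≤ M * ‖testToH1 w‖ := by
  have htranslate (y : E) (hy : ‖y‖ ≤ φ.rOut) :
      |∫ x, v x * (Δ (w : E → ℝ)) (x + y)| ≤ M * ‖testToH1 w‖ := by
    have hyΩ : (· + y) ⁻¹' tsupport w ⊆ Ω := fun x hx =>
      hφ (Metric.mem_cthickening_of_dist_le x (x + y) _ _ hx (by simpa using hy))
    have h := hM (testTranslate w y hyΩ)
    rw [setIntegral_mul_laplacian_eq_integral, norm_testToH1_testTranslate] at h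
    simpa only [coe_testTranslate, laplacian_comp_add_right] using h
  have hbound (y : E) : ‖φ.normed volume y * ∫ x, v x * (Δ (w : E → ℝ)) (x + y)‖
      ≤ φ.normed volume y * (M * ‖testToH1 w‖) := by
    rw [norm_mul, Real.norm_of_nonneg (φ.nonneg_normed y)]
    by_cases hy : y ∈ Function.support (φ.normed volume)
    · rw [φ.support_normed_eq, mem_ball_zero_iff] at hy
      exact mul_le_mul_of_nonneg_left (htranslate y hy.le) (φ.nonneg_normed y)
    · simp [Function.notMem_support.mp hy]
  have hcont : Continuous (Δ (w : E → ℝ)) ∧ HasCompactSupport (Δ (w : E → ℝ)) := by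
    rw [laplacian_testFunction (stdOrthonormalBasis ℝ E)]
    exact ⟨TestFunction.continuous _, TestFunction.hasCompactSupport _⟩
  rw [setIntegral_mul_laplacian_eq_integral, integral_convolution_mul φ.continuous_normed
    φ.hasCompactSupport_normed hv hcont.1 hcont.2]
  refine (norm_integral_le_of_norm_le (φ.integrable_normed.mul_const _)
    (ae_of_all _ hbound)).trans_eq ?_
  rw [integral_mul_const, φ.integral_normed, one_mul]

theorem exists_contDiffBump_forall_abs_convolution_sub_le {v : E → ℝ} (hv : UniformContinuous v)
    {δ : ℝ} (hδ : 0 < δ) {ε : ℝ} (hε : 0 < ε) :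
    ∃ φ : ContDiffBump (0 : E), φ.rOut ≤ δ ∧
      ∀ x, |(φ.normed volume ⋆[.lsmul ℝ ℝ, volume] v) x - v x| ≤ ε := by
  obtain ⟨δ', hδ', hvδ'⟩ := Metric.uniformContinuous_iff.mp hv ε hε
  have hmin : 0 < min δ δ' := lt_min hδ hδ'
  refine ⟨⟨min δ δ' / 2, min δ δ', half_pos hmin, half_lt_self hmin⟩, min_le_left _ _, fun x => ?_⟩
  exact ContDiffBump.dist_normed_convolution_le hv.continuous.aestronglyMeasurable fun y hy =>
    (hvδ' (lt_of_lt_of_le hy (min_le_right _ _))).le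

theorem exists_testFunction_approx {v : E → ℝ} (hv : Continuous v) (hvc : HasCompactSupport v)
    (hvΩ : ∀ x ∉ Ω, v x = 0) {M : ℝ}
    (hM : ∀ w : 𝓓(Ω, ℝ), |∫ x in (Ω : Set E), v x * (Δ (w : E → ℝ)) x| ≤ M * ‖testToH1 w‖)
    {ε : ℝ} (hε : 0 < ε) :
    ∃ w : 𝓓(Ω, ℝ), (∀ x, |w x - v x| ≤ 5 * ε) ∧
      ‖(testToH1 w).snd‖ ^ 2 ≤ M * ‖testToH1 w‖ := by
  let K : Set E := {x | ε - ε / 2 ≤ |v x|}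
  have hne {x : E} (hx : x ∈ K) : v x ≠ 0 :=
    abs_pos.mp ((sub_pos.mpr (half_lt_self hε)).trans_le hx)
  have hK : IsCompact K := hvc.of_isClosed_subset (isClosed_le continuous_const hv.abs)
    fun x hx => subset_tsupport v (hne hx)
  have hKΩ : K ⊆ Ω := fun x hx => by_contra fun h => hne hx (hvΩ x h)
  obtain ⟨δ, hδ, hKδ⟩ := hK.exists_cthickening_subset_open Ω.isOpen hKΩ
  obtain ⟨φ, hφδ, hclose⟩ := exists_contDiffBump_forall_abs_convolution_sub_le
    (hvc.uniformContinuous_of_continuous hv) hδ (half_pos hε)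
  let b : ContDiffBump (0 : ℝ) := ⟨ε, 2 * ε, hε, by linarith⟩
  let vφ : E → ℝ := φ.normed volume ⋆[.lsmul ℝ ℝ, volume] v
  have hvφ : ContDiff ℝ (⊤ : ℕ∞) vφ :=
    φ.hasCompactSupport_normed.contDiff_convolution_left _ φ.contDiff_normed hv.locallyIntegrable
  have hsupp : tsupport (fun x => softThreshold b (vφ x)) ⊆ K :=
    tsupport_softThreshold_comp_subset b hv hclose
  let w : 𝓓(Ω, ℝ) := ⟨fun x => softThreshold b (vφ x), (contDiff_softThreshold b).comp hvφ,
    hK.of_isClosed_subset (isClosed_tsupport _) hsupp, hsupp.trans hKΩ⟩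
  refine ⟨w, fun x => ?_, ?_⟩
  · have hb : |w x - vφ x| ≤ 2 * (2 * ε) := abs_softThreshold_sub_le b (vφ x)
    linarith [abs_sub_le (w x) (vφ x) (v x), hclose x]
  · have henergy : ∫ x in (Ω : Set E), ‖∇ w x‖ ^ 2
        ≤ -∫ x in (Ω : Set E), vφ x * (Δ (w : E → ℝ)) x :=
      setIntegral_norm_gradient_comp_sq_le (hvφ.of_le (by exact_mod_cast le_top))
        (hasDerivAt_softThreshold b) (fun t => ⟨sub_nonneg.mpr b.le_one, sub_le_self _ b.nonneg⟩)
        fun x => rfl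
    rw [norm_snd_testToH1_sq]
    exact henergy.trans <| (neg_le_abs _).trans <|
      abs_setIntegral_convolution_mul_laplacian_le hv hM φ w <|
        (Metric.cthickening_mono hφδ _).trans <|
          (Metric.cthickening_subset_of_subset _ hsupp).trans hKδ

end Mollification

section Existence

variable {E : Type*} [NormedAddCommGroup E] [InnerProductSpace ℝ E] [FiniteDimensional ℝ E]
  [Nontrivial E] [MeasurableSpace E] [BorelSpace E] {Ω : Opens E}

theorem norm_le_of_norm_snd_sq_le {R : ℝ} (hR : ∀ x ∈ Ω, ‖x‖ ≤ R) {z : L2Pair Ω}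
    (hz : z ∈ sobolevH10 Ω) {M : ℝ} (hM : 0 ≤ M) (h : ‖z.snd‖ ^ 2 ≤ M * ‖z‖) :
    ‖z‖ ≤ (1 + (2 * R) ^ 2) * M := by
  have hsq : ‖z‖ * ‖z‖ ≤ (1 + (2 * R) ^ 2) * M * ‖z‖ :=
    calc ‖z‖ * ‖z‖ = ‖z.fst‖ ^ 2 + ‖z.snd‖ ^ 2 := by
          rw [← WithLp.prod_norm_sq_eq_of_L2, sq]
      _ ≤ (2 * R) ^ 2 * ‖z.snd‖ ^ 2 + ‖z.snd‖ ^ 2 := by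
          gcongr
          exact norm_fst_sq_le_mul_norm_snd_sq hR hz
      _ = (1 + (2 * R) ^ 2) * ‖z.snd‖ ^ 2 := by ring
      _ ≤ (1 + (2 * R) ^ 2) * (M * ‖z‖) := by gcongr
      _ = (1 + (2 * R) ^ 2) * M * ‖z‖ := by ring
  obtain hz0 | hz0 := (norm_nonneg z).eq_or_lt
  · rw [← hz0]
    positivity
  · exact le_of_mul_le_mul_right hsq hz0

theorem exists_mem_sobolevH10_fst_eq (hΩ : Bornology.IsBounded (Ω : Set E)) {v : E → ℝ}
    (hv : Continuous v) (hvΩ : ∀ x ∉ Ω, v x = 0) {M : ℝ} (hM0 : 0 ≤ M)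
    (hM : ∀ w : 𝓓(Ω, ℝ), |∫ x in (Ω : Set E), v x * (Δ (w : E → ℝ)) x| ≤ M * ‖testToH1 w‖)
    (hv2 : MemLp v 2 (volume.restrict (Ω : Set E))) :
    ∃ z ∈ sobolevH10 Ω, z.fst = hv2.toLp v := by
  obtain ⟨R, hR⟩ := hΩ.exists_norm_le
  have : IsFiniteMeasure (volume.restrict (Ω : Set E)) :=
    ⟨by simpa using hΩ.measure_lt_top⟩
  have : CompleteSpace (sobolevH10 Ω) :=
    (Submodule.isClosed_topologicalClosure _).completeSpace_coe
  have hvc : HasCompactSupport v :=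
    HasCompactSupport.intro hΩ.isCompact_closure fun x hx => hvΩ x fun h => hx (subset_closure h)
  let T : sobolevH10 Ω →L[ℝ] Lp ℝ 2 (volume.restrict (Ω : Set E)) :=
    WithLp.fstL 2 ℝ _ _ ∘L (sobolevH10 Ω).subtypeL
  have hmem : hv2.toLp v ∈ closure (T '' Metric.closedBall 0 ((1 + (2 * R) ^ 2) * M)) := by
    refine Metric.mem_closure_iff.mpr fun ε hε => ?_
    obtain ⟨η, hη, hηε⟩ := exists_pos_mul_lt hε
      (measureUnivNNReal (volume.restrict (Ω : Set E)) ^ (2 : ENNReal).toReal⁻¹ * 5)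
    obtain ⟨w, hwv, hwM⟩ := exists_testFunction_approx hv hvc hvΩ hM hη
    have hw : testToH1 w ∈ sobolevH10 Ω := testToH1_mem_sobolevH10 w
    have hnorm : ‖testToH1 w‖ ≤ (1 + (2 * R) ^ 2) * M := norm_le_of_norm_snd_sq_le hR hw hM0 hwM
    refine ⟨T ⟨testToH1 w, hw⟩, Set.mem_image_of_mem T (mem_closedBall_zero_iff.mpr hnorm), ?_⟩
    rw [dist_comm, dist_eq_norm]
    refine (norm_toLp_sub_toLp_le (memLp_testFunction w 2) hv2 (by positivity)
      (ae_of_all _ hwv)).trans_lt ?_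
    rwa [← mul_assoc]
  rw [(isClosed_image_closedBall T _).closure_eq] at hmem
  obtain ⟨z, -, hz⟩ := hmem
  exact ⟨z, z.2, hz⟩

end Existence

section Limits

variable {E : Type*} [NormedAddCommGroup E] [InnerProductSpace ℝ E] [FiniteDimensional ℝ E]
  [MeasurableSpace E] [BorelSpace E] {Ω : Opens E}

theorem tendsto_testToH1_iff {ι : Type*} {l : Filter ι} {w : ι → 𝓓(Ω, ℝ)} {v : E → ℝ} {G : E → E}
    (hv : MemLp v 2 (volume.restrict (Ω : Set E))) (hG : MemLp G 2 (volume.restrict (Ω : Set E))) :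
    Tendsto (fun i => testToH1 (w i)) l (𝓝 (WithLp.toLp 2 (hv.toLp v, hG.toLp G))) ↔
      Tendsto (fun i => eLpNorm (fun x => v x - w i x) 2 (volume.restrict (Ω : Set E))) l (𝓝 0) ∧
      Tendsto (fun i => eLpNorm (fun x => G x - ∇ (w i) x) 2 (volume.restrict (Ω : Set E))) l
        (𝓝 0) := by
  simp only [← coe_testGradient]
  rw [← tendsto_testToLp_iff hv, ← tendsto_testToLp_iff hG]
  refine ⟨fun h => ⟨(WithLp.fstL 2 ℝ _ _).continuous.tendsto _ |>.comp h,
    (WithLp.sndL 2 ℝ _ _).continuous.tendsto _ |>.comp h⟩, fun h => ?_⟩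
  exact ((WithLp.prod_continuous_toLp 2 _ _).tendsto _).comp (h.1.prodMk_nhds h.2)

end Limits

section Euclidean

variable {d : ℕ} {Ω : Opens (EuclideanSpace ℝ (Fin d))}
  {v : EuclideanSpace ℝ (Fin d) → ℝ} {G : EuclideanSpace ℝ (Fin d) → EuclideanSpace ℝ (Fin d)}

theorem testH1Norm_eq_norm_testToH1 (w : 𝓓(Ω, ℝ)) : testH1Norm Ω w = ‖testToH1 w‖ := by
  rw [testH1Norm, ← norm_testToH1_sq, Real.sqrt_sq (norm_nonneg _)]

theorem IsWeakGradient.hasWeakGradient (h : IsWeakGradient Ω v G) : HasWeakGradient Ω v G :=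
  fun w j => by
    simpa only [← inner_testGradient, coe_testGradient, EuclideanSpace.inner_single_left, map_one,
      one_mul] using h w (EuclideanSpace.single j 1)

theorem isH10_iff_toLp_mem_sobolevH10 : IsH10 Ω v G ↔
    ∃ (hv : MemLp v 2 (volume.restrict Ω)) (hG : MemLp G 2 (volume.restrict Ω)),
      WithLp.toLp 2 (hv.toLp v, hG.toLp G) ∈ sobolevH10 Ω := by
  constructor
  · rintro ⟨⟨hv, hG, -⟩, w, hw⟩
    exact ⟨hv, hG, mem_closure_of_tendsto ((tendsto_testToH1_iff hv hG).mpr hw)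
      (Eventually.of_forall fun n => ⟨w n, rfl⟩)⟩
  · rintro ⟨hv, hG, hmem⟩
    have hgrad : IsWeakGradient Ω v G :=
      (isWeakGradient_of_mem_sobolevH10 hmem).congr_ae hv.coeFn_toLp hG.coeFn_toLp
    obtain ⟨y, hy, hlim⟩ := mem_closure_iff_seq_limit.mp hmem
    choose w hw using hy
    obtain rfl : (fun n => testToH1 (w n)) = y := funext hw
    exact ⟨⟨hv, hG, hgrad.hasWeakGradient⟩, w, (tendsto_testToH1_iff hv hG).mp hlim⟩

end Euclidean

section Dirichlet

variable {d : ℕ} {Ω : Opens (EuclideanSpace ℝ (Fin d))}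
  {φ : C(frontier (Ω : Set (EuclideanSpace ℝ (Fin d))), ℝ)}
  {u Φ h : EuclideanSpace ℝ (Fin d) → ℝ}

theorem IsH10.ae_eq_of_setIntegral_inner_eq [NeZero d]
    (hΩ : Bornology.IsBounded (Ω : Set (EuclideanSpace ℝ (Fin d))))
    {v v' : EuclideanSpace ℝ (Fin d) → ℝ}
    {G G' : EuclideanSpace ℝ (Fin d) → EuclideanSpace ℝ (Fin d)} (hv : IsH10 Ω v G)
    (hv' : IsH10 Ω v' G')
    (h : ∀ w : 𝓓(Ω, ℝ), ∫ x in (Ω : Set (EuclideanSpace ℝ (Fin d))), inner ℝ (G x) (∇ w x)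
      = ∫ x in (Ω : Set (EuclideanSpace ℝ (Fin d))), inner ℝ (G' x) (∇ w x)) :
    v =ᵐ[volume.restrict (Ω : Set (EuclideanSpace ℝ (Fin d)))] v' := by
  obtain ⟨hv2, hG2, hmem⟩ := isH10_iff_toLp_mem_sobolevH10.mp hv
  obtain ⟨hv2', hG2', hmem'⟩ := isH10_iff_toLp_mem_sobolevH10.mp hv'
  have hsnd (w : 𝓓(Ω, ℝ)) := (inner_toLp_toLp hG2 (memLp_testFunction (testGradient w) 2)).trans <|
    (h w).trans (inner_toLp_toLp hG2' (memLp_testFunction (testGradient w) 2)).symm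
  have heq := eq_of_inner_snd_testGradient_eq hΩ hmem hmem' hsnd
  exact (MemLp.toLp_eq_toLp_iff hv2 hv2').mp congr(($heq).fst)

theorem exists_isH10_of_continuous [NeZero d]
    (hΩ : Bornology.IsBounded (Ω : Set (EuclideanSpace ℝ (Fin d))))
    {v : EuclideanSpace ℝ (Fin d) → ℝ} (hv : Continuous v) (hvΩ : ∀ x ∉ Ω, v x = 0)
    (hlap : LaplacianMemHNegOne Ω v) :
    ∃ G, IsH10 Ω v G ∧ ∀ w : 𝓓(Ω, ℝ),
      ∫ x in (Ω : Set (EuclideanSpace ℝ (Fin d))),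
          v x * (Δ (w : EuclideanSpace ℝ (Fin d) → ℝ)) x
        = -∫ x in (Ω : Set (EuclideanSpace ℝ (Fin d))), inner ℝ (G x) (∇ w x) := by
  obtain ⟨M, hM0, hM⟩ := hlap
  simp only [testH1Norm_eq_norm_testToH1] at hM
  have hvc : HasCompactSupport v :=
    HasCompactSupport.intro hΩ.isCompact_closure fun x hx => hvΩ x fun h => hx (subset_closure h)
  have hv2 : MemLp v 2 (volume.restrict (Ω : Set (EuclideanSpace ℝ (Fin d)))) :=
    hv.memLp_of_hasCompactSupport hvc
  obtain ⟨z, hz, hzv⟩ := exists_mem_sobolevH10_fst_eq hΩ hv hvΩ hM0 hM hv2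
  have hG2 := Lp.memLp z.snd
  have hfst : z.fst =ᵐ[volume.restrict (Ω : Set (EuclideanSpace ℝ (Fin d)))] v := by
    rw [hzv]
    exact hv2.coeFn_toLp
  refine ⟨z.snd, isH10_iff_toLp_mem_sobolevH10.mpr ⟨hv2, hG2, ?_⟩, ?_⟩
  · rwa [← hzv, Lp.toLp_coeFn]
  · exact ((isWeakGradient_of_mem_sobolevH10 hz).congr_ae hfst .rfl).setIntegral_mul_laplacian
      (hv.continuousOn.locallyIntegrableOn Ω.isOpen.measurableSet)
      (locallyIntegrableOn_of_locallyIntegrable_restrict (hG2.locallyIntegrable one_le_two))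

theorem IsClassicalSolution.isAdmissibleExtension (hu : IsClassicalSolution Ω φ u) :
    IsAdmissibleExtension Ω φ u where
  continuousOn := hu.continuousOn
  boundary := hu.boundary
  laplacian := ⟨0, le_rfl, fun w => by
    rw [setIntegral_mul_laplacian_eq_zero_of_harmonicOnNhd hu.harmonic, abs_zero, zero_mul]⟩

theorem IsClassicalSolution.isVariationalSolutionFrom [NeZero d]
    (hΩ : Bornology.IsBounded (Ω : Set (EuclideanSpace ℝ (Fin d))))
    (hu : IsClassicalSolution Ω φ u) (hΦ : IsAdmissibleExtension Ω φ Φ) :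
    IsVariationalSolutionFrom Ω Φ u := by
  have hmeas : MeasurableSet (Ω : Set (EuclideanSpace ℝ (Fin d))) := Ω.isOpen.measurableSet
  let v := (Ω : Set (EuclideanSpace ℝ (Fin d))).indicator fun x => Φ x - u x
  have hvΩ : ∀ x ∈ Ω, v x = Φ x - u x := fun x hx => Set.indicator_of_mem hx _
  have hv : Continuous v :=
    continuous_indicator (fun x hx => by rw [hΦ.boundary ⟨x, hx⟩, hu.boundary ⟨x, hx⟩, sub_self])
      (hΦ.continuousOn.sub hu.continuousOn)
  have hlap (w : 𝓓(Ω, ℝ)) : ∫ x in (Ω : Set (EuclideanSpace ℝ (Fin d))),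
        v x * (Δ (w : EuclideanSpace ℝ (Fin d) → ℝ)) x
      = ∫ x in (Ω : Set (EuclideanSpace ℝ (Fin d))),
          Φ x * (Δ (w : EuclideanSpace ℝ (Fin d) → ℝ)) x := by
    rw [← setIntegral_sub_mul_laplacian_of_harmonicOnNhd (hΦ.continuousOn.mono subset_closure)
      hu.harmonic]
    exact setIntegral_congr_fun hmeas fun x hx => by rw [hvΩ x hx]
  obtain ⟨G, hG, hgreen⟩ := exists_isH10_of_continuous hΩ hv
    (fun x hx => Set.indicator_of_notMem hx _) (hΦ.laplacian.imp fun M hM => by simpa only [hlap])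
  refine ⟨hu.harmonic, v, G, hG, fun w => (hlap w).symm.trans (hgreen w), ?_⟩
  filter_upwards [ae_restrict_mem hmeas] with x hx
  rw [hvΩ x hx, sub_sub_cancel]

theorem IsVariationalSolutionFrom.eqOn [NeZero d]
    (hΩ : Bornology.IsBounded (Ω : Set (EuclideanSpace ℝ (Fin d))))
    {h' : EuclideanSpace ℝ (Fin d) → ℝ} (hh : IsVariationalSolutionFrom Ω Φ h)
    (hh' : IsVariationalSolutionFrom Ω Φ h') : Set.EqOn h h' Ω := by
  obtain ⟨hharm, v, G, hv, hgreen, hae⟩ := hh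
  obtain ⟨hharm', v', G', hv', hgreen', hae'⟩ := hh'
  have hvv' := hv.ae_eq_of_setIntegral_inner_eq hΩ hv' fun w =>
    neg_injective ((hgreen w).symm.trans (hgreen' w))
  refine Measure.eqOn_open_of_ae_eq (μ := volume) ?_ Ω.isOpen hharm.contDiffOn.continuousOn
    hharm'.contDiffOn.continuousOn
  filter_upwards [hvv', hae, hae'] with x hx hhx hhx'
  rw [hhx, hhx', hx]

end Dirichlet

theorem proposition2p3_general (d : ℕ) [NeZero d]
    (Ω : TopologicalSpace.Opens (EuclideanSpace ℝ (Fin d)))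
    (hbdd : Bornology.IsBounded (Ω : Set (EuclideanSpace ℝ (Fin d))))
    (φ : C(frontier (Ω : Set (EuclideanSpace ℝ (Fin d))), ℝ))
    (u : EuclideanSpace ℝ (Fin d) → ℝ)
    (hu : IsClassicalSolution Ω φ u) :
    IsVariationalSolution Ω φ u ∧
    (∀ Φ : EuclideanSpace ℝ (Fin d) → ℝ,
      IsAdmissibleExtension Ω φ Φ → IsVariationalSolutionFrom Ω Φ u) ∧
    ∀ h : EuclideanSpace ℝ (Fin d) → ℝ, IsVariationalSolution Ω φ h →
      Set.EqOn u h (Ω : Set (EuclideanSpace ℝ (Fin d))) := by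
  have hproduced (Φ : EuclideanSpace ℝ (Fin d) → ℝ) (hΦ : IsAdmissibleExtension Ω φ Φ) :
      IsVariationalSolutionFrom Ω Φ u := hu.isVariationalSolutionFrom hbdd hΦ
  refine ⟨⟨u, hu.isAdmissibleExtension, hproduced u hu.isAdmissibleExtension⟩, hproduced, ?_⟩
  rintro h ⟨Φ, hΦ, hh⟩
  exact (hproduced Φ hΦ).eqOn hbdd hh

/-- If `D(φ)` has a classical solution `u`, then `u` is a variational solution of `D(φ)`, it is
produced by every admissible extension of `φ`, and it is the only variational solution: every
variational solution of `D(φ)` coincides with `u` on `Ω`. -/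
theorem proposition2p3 (d : ℕ) (hd : 2 ≤ d)
    (Ω : TopologicalSpace.Opens (EuclideanSpace ℝ (Fin d)))
    (hconn : IsConnected (Ω : Set (EuclideanSpace ℝ (Fin d))))
    (hbdd : Bornology.IsBounded (Ω : Set (EuclideanSpace ℝ (Fin d))))
    (φ : C(frontier (Ω : Set (EuclideanSpace ℝ (Fin d))), ℝ))
    (u : EuclideanSpace ℝ (Fin d) → ℝ)
    (hu : IsClassicalSolution Ω φ u) :
    IsVariationalSolution Ω φ u ∧
    (∀ Φ : EuclideanSpace ℝ (Fin d) → ℝ,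
      IsAdmissibleExtension Ω φ Φ → IsVariationalSolutionFrom Ω Φ u) ∧
    ∀ h : EuclideanSpace ℝ (Fin d) → ℝ, IsVariationalSolution Ω φ h →
      Set.EqOn u h (Ω : Set (EuclideanSpace ℝ (Fin d))) := by
  have : NeZero d := ⟨by lia⟩
  exact proposition2p3_general d Ω hbdd φ u hu
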